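/- **Setting.** Games are finite extensive-form games in which a behavior strategy of a player assigns to each of her information sets a distribution over the available actions. A *pseudogame* $(\tilde G,\alpha,\beta)$ is a game tree with information sets in which every leaf $z$ carries, for each player $i$, only bounds $\alpha_i(z)\le\beta_i(z)$ instead of a utility. A strategy profile $\sigma$ is an $\varepsilon$-Nash equilibrium of the pseudogame if, for every player $i$, $\max_{\sigma_i'}\beta_i(\sigma_i',\sigma_{-i})-\alpha_i(\sigma)\le\varepsilon$ (expected values over the leaf reached). The pseudogame is a *trunk* of a game $(G,u)$ if its tree is obtained from $G$ by collapsing some internal nodes into leaves (deleting their descendants and removing them from their information sets), and $\alpha_i(h)\le u_i(z)\le\beta_i(h)$ for every player $i$, every leaf $h$ of $\tilde G$ and every leaf $z$ of $G$ that equals or descends from $h$. An *$\varepsilon$-certificate* of $G$ is a trunk of $G$ together with an $\varepsilon$-Nash equilibrium of it; its number of nodes is the number of nodes of the trunk. **The game.** For $T\ge 1$ let $G_T$ be the following game of $T$ rounds of matching pennies. In each round P1 chooses heads or tails, and then P2 chooses heads or tails without having seen P1's choice in this round. After each round P2 learns what P1 played, but P1 does not learn what P2 played; both players remember their own moves. For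 each round in which the choices agree, P1 gains $1/T$ and P2 loses $1/T$; rounds in which they differ are worth $0$. **Theorem.** 1. For every $T\ge1$, $G_T$ is a two-player zero-sum game with perfect recall, without nature nodes, with payoffs in $[-1,1]$, alternating moves, exactly two actions at every internal node, and all leaves at depth $2T$; it has $N=2^{2T}$ leaves. 2. There are constants $c,C>0$ such that for all $T\ge1$ and all $\varepsilon\ge0$, every $\varepsilon$-certificate of $G_T$ has at least $c\,N^{1-C\varepsilon}$ nodes, where $N=2^{2T}$. 3. Hence small approximate certificates need not exist: for every $s<1$ there is $\varepsilon>0$ such that for every $K$ there is a game $G$ with all the properties listed in 1 (for some uniform depth $d$) such that every $\varepsilon$-certificate of $G$ has more than $K\,M^{s}$ nodes, where $M$ is the number of nodes of $G$. -/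

import Mathlib

/-! ## Extensive-form games

Histories are lists of actions with the *most recent action first*: the root is `[]`, and the child
of `h` reached by the action `a` is `a :: h`. `ι` is the set of players, `A` the set of actions, and
`L` a set of names for information sets. -/

/-- The tree and the information structure of an extensive-form game (everything except payoffs). -/
structure GameTree (ι A L : Type) [Fintype A] [DecidableEq A] where
  /-- The finite set of histories. -/
  nodes : Finset (List A)
  root_mem : [] ∈ nodes
  parent_mem : ∀ a h, a :: h ∈ nodes → h ∈ nodes
  /-- The player who acts at a node; `none` is nature. Only relevant at internal nodes. -/
  owner : List A → Option ι
  /-- The name of the information set of a node: two internal nodes of the *same* player lie in the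
  same information set iff their names agree. -/
  info : List A → L
  actions_eq : ∀ h ∈ nodes, ∀ h' ∈ nodes, (∃ a, a :: h ∈ nodes) → (∃ a, a :: h' ∈ nodes) →
    owner h = owner h' → owner h ≠ none → info h = info h' →
    ∀ a, a :: h ∈ nodes ↔ a :: h' ∈ nodes
  /-- Nature's distribution; only relevant at internal nodes of nature. -/
  chance : List A → A → ℝ
  chance_nonneg : ∀ h, owner h = none → ∀ a, a :: h ∈ nodes → 0 ≤ chance h a
  chance_sum : ∀ h, owner h = none → (∃ a, a :: h ∈ nodes) →
    ∑ a with a :: h ∈ nodes, chance h a = 1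

namespace GameTree

variable {ι A L : Type} [Fintype A] [DecidableEq A]

/-- The actions available at `h`. -/
def actions (F : GameTree ι A L) (h : List A) : Finset A := {a | a :: h ∈ F.nodes}

/-- The leaves of the tree. -/
def leaves (F : GameTree ι A L) : Finset (List A) := {h ∈ F.nodes | F.actions h = ∅}

/-- The internal (non-leaf) nodes of the tree. -/
def internal (F : GameTree ι A L) : Finset (List A) := {h ∈ F.nodes | F.actions h ≠ ∅}

/-- The sequence of player `i` at a node: the information sets she met and the actions she took
there. -/
def sequence [DecidableEq ι] (F : GameTree ι A L) (i : ι) : List A → List (L × A)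
  | [] => []
  | a :: h => if F.owner h = some i then (F.info h, a) :: F.sequence i h else F.sequence i h

/-- Perfect recall: nodes in the same information set of a player have the same sequence of that
player. -/
def PerfectRecall [DecidableEq ι] (F : GameTree ι A L) : Prop :=
  ∀ i, ∀ h ∈ F.internal, ∀ h' ∈ F.internal, F.owner h = some i → F.owner h' = some i →
    F.info h = F.info h' → F.sequence i h = F.sequence i h'

/-- A behavior strategy of player `i`: a distribution over the available actions at each of her
information sets (values of `prob` elsewhere are irrelevant). -/
structure Strategy (F : GameTree ι A L) (i : ι) where
  prob : L → A → ℝ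
  nonneg : ∀ h ∈ F.internal, F.owner h = some i → ∀ a ∈ F.actions h, 0 ≤ prob (F.info h) a
  sum_eq_one : ∀ h ∈ F.internal, F.owner h = some i →
    ∑ a ∈ F.actions h, prob (F.info h) a = 1

/-- A strategy profile. -/
abbrev Profile (F : GameTree ι A L) : Type := ∀ i : ι, F.Strategy i

/-- The probability that action `a` is chosen at node `h`. -/
def stepProb (F : GameTree ι A L) (σ : F.Profile) (h : List A) (a : A) : ℝ :=
  match F.owner h with
  | none => F.chance h a
  | some i => (σ i).prob (F.info h) a

/-- The probability that a node is reached under a strategy profile. -/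
def reach (F : GameTree ι A L) (σ : F.Profile) : List A → ℝ
  | [] => 1
  | a :: h => F.reach σ h * F.stepProb σ h a

/-- The expectation of a function `v` of the leaf reached under a strategy profile. -/
def value (F : GameTree ι A L) (σ : F.Profile) (v : List A → ℝ) : ℝ :=
  ∑ z ∈ F.leaves, F.reach σ z * v z

/-- The best-response value of player `i` with leaf payoffs `v` against the strategies of the other
players in `σ` (the strategy `σ i` is overwritten). -/
noncomputable def bestResponseValue [DecidableEq ι] (F : GameTree ι A L) (σ : F.Profile) (i : ι)
    (v : List A → ℝ) : ℝ :=
  ⨆ τ : F.Strategy i, F.value (Function.update σ i τ) v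

theorem stepProb_mem (F : GameTree ι A L) (σ : F.Profile) {h : List A} {a : A}
    (ha : a :: h ∈ F.nodes) : 0 ≤ F.stepProb σ h a ∧ F.stepProb σ h a ≤ 1 := by
  have hact : a ∈ F.actions h := by simpa [actions] using ha
  have hint : h ∈ F.internal := by
    simp only [internal, Finset.mem_filter]
    exact ⟨F.parent_mem a h ha, Finset.ne_empty_of_mem hact⟩
  unfold stepProb
  cases ho : F.owner h with
  | none =>
    refine ⟨F.chance_nonneg h ho a ha, ?_⟩
    simp only
    rw [← F.chance_sum h ho ⟨a, ha⟩]
    exact Finset.single_le_sum (f := F.chance h)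
      (fun b hb => F.chance_nonneg h ho b (by simpa using hb)) (by simpa using ha)
  | some i =>
    refine ⟨(σ i).nonneg h hint ho a hact, ?_⟩
    simp only
    rw [← (σ i).sum_eq_one h hint ho]
    exact Finset.single_le_sum (f := (σ i).prob (F.info h))
      (fun b hb => (σ i).nonneg h hint ho b hb) hact

theorem reach_mem (F : GameTree ι A L) (σ : F.Profile) :
    ∀ h ∈ F.nodes, 0 ≤ F.reach σ h ∧ F.reach σ h ≤ 1
  | [], _ => by simp [reach]
  | a :: h, hh => by
    have h1 := F.reach_mem σ h (F.parent_mem a h hh)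
    have h2 := F.stepProb_mem σ hh
    exact ⟨mul_nonneg h1.1 h2.1, mul_le_one₀ h1.2 h2.1 h2.2⟩

/-- The supremum in `bestResponseValue` is over a bounded set. -/
theorem bddAbove_value [DecidableEq ι] (F : GameTree ι A L) (σ : F.Profile) (i : ι)
    (v : List A → ℝ) :
    BddAbove (Set.range fun τ : F.Strategy i => F.value (Function.update σ i τ) v) := by
  refine ⟨∑ z ∈ F.leaves, |v z|, ?_⟩
  rintro _ ⟨τ, rfl⟩
  refine Finset.sum_le_sum fun z hz => ?_
  have h := F.reach_mem (Function.update σ i τ) z (Finset.mem_filter.1 hz).1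
  calc _ ≤ F.reach (Function.update σ i τ) z * |v z| :=
        mul_le_mul_of_nonneg_left (le_abs_self _) h.1
    _ ≤ 1 * |v z| := mul_le_mul_of_nonneg_right h.2 (abs_nonneg _)
    _ = |v z| := one_mul _

end GameTree

/-- An extensive-form game: a tree with a utility for each player at each leaf. -/
structure Game (ι A L : Type) [Fintype A] [DecidableEq A] extends GameTree ι A L where
  /-- Only relevant at leaves. -/
  utility : ι → List A → ℝ

/-- A pseudogame: for each player and each leaf only a lower and an upper bound on the utility is
given. -/
structure Pseudogame (ι A L : Type) [Fintype A] [DecidableEq A] extends GameTree ι A L where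
  /-- The lower bounds `α i`; only relevant at leaves. -/
  lower : ι → List A → ℝ
  /-- The upper bounds `β i`; only relevant at leaves. -/
  upper : ι → List A → ℝ
  lower_le_upper : ∀ i, ∀ z ∈ toGameTree.leaves, lower i z ≤ upper i z

namespace Pseudogame

variable {ι A L : Type} [Fintype A] [DecidableEq A]

/-- `σ` is an `ε`-Nash equilibrium of the pseudogame: for each player, the optimistic best-response
value exceeds the pessimistic value of `σ` by at most `ε`. -/
def IsNash [DecidableEq ι] (P : Pseudogame ι A L) (ε : ℝ) (σ : P.toGameTree.Profile) : Prop :=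
  ∀ i, P.toGameTree.bestResponseValue σ i (P.upper i) - P.toGameTree.value σ (P.lower i) ≤ ε

/-- `P` is a trunk of `G`: some internal nodes of `G` are collapsed into leaves (their descendants
disappear, and they leave their information sets), nothing else changes, and the bounds at every
leaf of `P` are correct for all leaves of `G` below it (`h <:+ z`: `z` is `h` or a descendant
of `h`). -/
structure IsTrunk (P : Pseudogame ι A L) (G : Game ι A L) : Prop where
  nodes_subset : P.nodes ⊆ G.nodes
  actions_eq : ∀ h ∈ P.internal, P.actions h = G.actions h
  owner_eq : ∀ h ∈ P.internal, P.owner h = G.owner h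
  info_eq : ∀ h ∈ P.internal, P.info h = G.info h
  chance_eq : ∀ h ∈ P.internal, P.owner h = none → ∀ a ∈ P.actions h, P.chance h a = G.chance h a
  bounds : ∀ i, ∀ h ∈ P.leaves, ∀ z ∈ G.leaves, h <:+ z →
    P.lower i h ≤ G.utility i z ∧ G.utility i z ≤ P.upper i h

end Pseudogame

namespace Game

variable {A L : Type} [Fintype A] [DecidableEq A]

/-- `(P, σ)` is an `ε`-certificate of the game `G`. -/
def IsCertificate {ι : Type} [DecidableEq ι] (G : Game ι A L) (ε : ℝ) (P : Pseudogame ι A L)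
    (σ : P.toGameTree.Profile) : Prop :=
  P.IsTrunk G ∧ P.IsNash ε σ

/-- A two-player (players `0` and `1`) zero-sum game with payoffs in `[-1, 1]`, perfect recall, no
nature nodes, alternating moves, exactly `b` actions at every internal node, and all leaves at
depth `d`. -/
structure IsUniformAlternating (G : Game (Fin 2) A L) (b d : ℕ) : Prop where
  zero_sum : ∀ z ∈ G.leaves, G.utility 1 z = -G.utility 0 z
  bounded : ∀ i, ∀ z ∈ G.leaves, |G.utility i z| ≤ 1
  perfect_recall : G.toGameTree.PerfectRecall
  no_nature : ∀ h ∈ G.internal, G.owner h ≠ none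
  alternating : ∀ h ∈ G.internal, ∀ a, a :: h ∈ G.internal → G.owner (a :: h) ≠ G.owner h
  branching : ∀ h ∈ G.internal, (G.actions h).card = b
  depth : ∀ z ∈ G.leaves, z.length = d

end Game

/-! ## Repeated matching pennies

In each round player `0` moves, then player `1` moves without having seen that move. After the round
player `1` learns the move of player `0`, while player `0` learns nothing. A history after `k` rounds
with moves `x₁, y₁, …, xₖ, yₖ` is the list `[yₖ, xₖ, …, y₁, x₁]`. -/

namespace MatchingPennies

/-- The moves of the first player in the completed rounds (for histories of even length). -/
def firstMoves : List Bool → List Bool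
  | _ :: x :: h => x :: firstMoves h
  | _ => []

/-- The number of rounds in which the two moves agree (for histories of even length). -/
def numMatches : List Bool → ℕ
  | y :: x :: h => (if x = y then 1 else 0) + numMatches h
  | _ => 0

/-- At the start of a round player `0` moves, knowing only her own earlier moves; in the middle of a
round player `1` moves, knowing all moves of the earlier rounds but not the move of player `0` in
this round. -/
def info (h : List Bool) : List Bool := if Even h.length then firstMoves h else h.tail

/-- The game of `T` rounds of matching pennies: player `0` wins `1 / T` from player `1` for every
round in which the moves agree. -/
noncomputable def game (T : ℕ) : Game (Fin 2) Bool (List Bool) where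
  nodes := (List.finite_length_le Bool (2 * T)).toFinset
  root_mem := by simp
  parent_mem a h := by simp; omega
  owner h := some (if Even h.length then 0 else 1)
  info := info
  actions_eq := by
    rintro h - h' - ⟨b, hb⟩ ⟨b', hb'⟩ - - - a
    simp at hb hb' ⊢
    omega
  chance _ _ := 0
  chance_nonneg := by simp
  chance_sum := by simp
  utility i z := if i = 0 then (numMatches z : ℝ) / T else -((numMatches z : ℝ) / T)

end MatchingPennies

/-! Each player has a deviation whose optimistic value can be controlled. A fair coin guarantees P1
an optimistic value of at least 1/2, whatever P2 does and wherever the trunk is cut off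
(`half_le_value_fair`). P2 knows P1's past moves, hence the probabilities `p`, `q = 1 - p` with
which P1's strategy plays heads and tails in the current round; exchanging them gives match
probability `2pq` (`mirrorStrategy`). Adding the two equilibrium inequalities, and using that the
lower bounds at a leaf sum to at most 0, shows that the mirror strategy still faces about `T/2`
matches, up to `2εT`.

So P1 must randomize almost fairly in most rounds, and randomness costs leaves: the entropy of the
leaf reached is at most the logarithm of the number of leaves. Both moves of a round have entropy
`H(p) ≥ log 2 - 1 + 4pq`, so a round contributes at least `2 log 2 - 2` plus four times its match
probability (`gibbs_two`, `value_mirror_le_log`). Together the bounds give `log #leaves ≥ 2T log 2 -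
8εT`, that is, `#leaves ≥ N^(1 - 4ε / log 2)`.

Both expectations are estimated by potentials on the nodes that are sub- or supermartingales; early
leaves are handled by comparing the potential with the bounds there. -/

/-! ### Leaves below a node, backward induction and martingale inequalities. -/

theorem List.eq_or_cons_suffix_of_suffix {A : Type*} {h z : List A} (hs : h <:+ z) :
    z = h ∨ ∃ a, a :: h <:+ z := by
  obtain ⟨l, rfl⟩ := hs
  induction l using List.reverseRecOn with
  | nil => exact Or.inl rfl
  | append_singleton l a => exact Or.inr ⟨a, l, by simp⟩

namespace GameTree

variable {ι A L : Type} [Fintype A] [DecidableEq A]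

theorem mem_actions {F : GameTree ι A L} {h : List A} {a : A} :
    a ∈ F.actions h ↔ a :: h ∈ F.nodes := by
  simp [actions]

theorem mem_internal_of_cons {F : GameTree ι A L} {h : List A} {a : A} (ha : a :: h ∈ F.nodes) :
    h ∈ F.internal :=
  Finset.mem_filter.2 ⟨F.parent_mem a h ha, Finset.ne_empty_of_mem (mem_actions.2 ha)⟩

theorem mem_leaves_or_internal {F : GameTree ι A L} {h : List A} (hh : h ∈ F.nodes) :
    h ∈ F.leaves ∨ h ∈ F.internal := by
  simp only [leaves, internal, Finset.mem_filter]
  tauto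

theorem mem_nodes_of_suffix {F : GameTree ι A L} {h z : List A} (hz : z ∈ F.nodes)
    (hs : h <:+ z) : h ∈ F.nodes := by
  obtain ⟨l, rfl⟩ := hs
  induction l with
  | nil => exact hz
  | cons a l ih => exact ih (F.parent_mem _ _ hz)

/-- The leaves that equal or descend from `h`. -/
def leavesBelow (F : GameTree ι A L) (h : List A) : Finset (List A) := {z ∈ F.leaves | h <:+ z}

theorem leavesBelow_nil (F : GameTree ι A L) : F.leavesBelow [] = F.leaves := by
  simp [leavesBelow]

theorem leavesBelow_of_mem_leaves {F : GameTree ι A L} {h : List A} (hh : h ∈ F.leaves) :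
    F.leavesBelow h = {h} := by
  ext z
  simp only [leavesBelow, Finset.mem_filter, Finset.mem_singleton]
  constructor
  · rintro ⟨hz, hs⟩
    rcases List.eq_or_cons_suffix_of_suffix hs with h1 | ⟨a, ha⟩
    · exact h1
    · have h2 := mem_actions.2 (mem_nodes_of_suffix (Finset.mem_filter.1 hz).1 ha)
      rw [(Finset.mem_filter.1 hh).2] at h2
      simp at h2
  · rintro rfl
    exact ⟨hh, List.suffix_rfl⟩

theorem leavesBelow_of_mem_internal {F : GameTree ι A L} {h : List A} (hh : h ∈ F.internal) :
    F.leavesBelow h = (F.actions h).biUnion fun a => F.leavesBelow (a :: h) := by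
  ext z
  simp only [leavesBelow, Finset.mem_filter, Finset.mem_biUnion]
  constructor
  · rintro ⟨hz, hs⟩
    rcases List.eq_or_cons_suffix_of_suffix hs with rfl | ⟨a, ha⟩
    · exact absurd (Finset.mem_filter.1 hz).2 (Finset.mem_filter.1 hh).2
    · exact ⟨a, mem_actions.2 (mem_nodes_of_suffix (Finset.mem_filter.1 hz).1 ha), hz, ha⟩
  · rintro ⟨a, -, hz, hs⟩
    exact ⟨hz, (List.suffix_cons a h).trans hs⟩

theorem pairwiseDisjoint_leavesBelow (F : GameTree ι A L) (h : List A) (s : Set A) :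
    s.PairwiseDisjoint fun a => F.leavesBelow (a :: h) := by
  intro a _ b _ hab
  refine Finset.disjoint_left.2 fun z hz hz' => hab ?_
  have h1 := (Finset.mem_filter.1 hz).2
  have h2 := (Finset.mem_filter.1 hz').2
  have h3 := (List.suffix_of_suffix_length_le h1 h2 (by simp)).eq_of_length (by simp)
  exact (List.cons.inj h3).1

theorem sum_leavesBelow_of_mem_internal {F : GameTree ι A L} {h : List A} (hh : h ∈ F.internal)
    {M : Type} [AddCommMonoid M] (g : List A → M) :
    ∑ z ∈ F.leavesBelow h, g z = ∑ a ∈ F.actions h, ∑ z ∈ F.leavesBelow (a :: h), g z := by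
  rw [leavesBelow_of_mem_internal hh, Finset.sum_biUnion (F.pairwiseDisjoint_leavesBelow h _)]

/-- Induction on a game tree from the leaves to the root. -/
theorem backward_induction {F : GameTree ι A L} {p : List A → Prop}
    (hleaf : ∀ h ∈ F.leaves, p h)
    (hint : ∀ h ∈ F.internal, (∀ a ∈ F.actions h, p (a :: h)) → p h) :
    ∀ h ∈ F.nodes, p h := by
  -- Induction on the distance to the maximal depth; at distance 0 a child would be too deep.
  have key : ∀ n h, h ∈ F.nodes → F.nodes.sup List.length - h.length ≤ n → p h := by
    intro n
    induction n with
    | zero =>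
      intro h hh hn
      rcases mem_leaves_or_internal hh with h1 | h1
      · exact hleaf h h1
      · refine hint h h1 fun a ha => ?_
        have h2 : (a :: h).length ≤ F.nodes.sup List.length := Finset.le_sup (mem_actions.1 ha)
        rw [List.length_cons] at h2
        omega
    | succ n ih =>
      intro h hh hn
      rcases mem_leaves_or_internal hh with h1 | h1
      · exact hleaf h h1
      · refine hint h h1 fun a ha => ih _ (mem_actions.1 ha) ?_
        rw [List.length_cons]
        omega
  exact fun h hh => key _ h hh le_rfl

theorem leavesBelow_nonempty {F : GameTree ι A L} : ∀ h ∈ F.nodes, (F.leavesBelow h).Nonempty := by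
  refine backward_induction (fun h hh => ?_) fun h hh ih => ?_
  · simp [leavesBelow_of_mem_leaves hh]
  · obtain ⟨a, ha⟩ := Finset.nonempty_iff_ne_empty.2 (Finset.mem_filter.1 hh).2
    obtain ⟨z, hz⟩ := ih a ha
    rw [leavesBelow_of_mem_internal hh]
    exact ⟨z, Finset.mem_biUnion.2 ⟨a, ha, hz⟩⟩

/-- The expectation of a submartingale at the leaf reached is at least its value at the root. -/
theorem le_value_of_submartingale (F : GameTree ι A L) (σ : F.Profile) (φ : List A → ℝ)
    (hφ : ∀ h ∈ F.internal, φ h ≤ ∑ a ∈ F.actions h, F.stepProb σ h a * φ (a :: h)) :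
    φ [] ≤ F.value σ φ := by
  -- Localized to the subtree of `h` and weighted by the reach probability, the claim passes from
  -- children to parent.
  have key : ∀ h ∈ F.nodes, F.reach σ h * φ h ≤ ∑ z ∈ F.leavesBelow h, F.reach σ z * φ z := by
    refine backward_induction (fun h hh => ?_) fun h hh ih => ?_
    · simp [leavesBelow_of_mem_leaves hh]
    · rw [sum_leavesBelow_of_mem_internal hh]
      refine le_trans ?_ (Finset.sum_le_sum ih)
      have := mul_le_mul_of_nonneg_left (hφ h hh) (F.reach_mem σ h (Finset.mem_filter.1 hh).1).1
      simpa [reach, Finset.mul_sum, mul_assoc] using this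
  simpa [reach, leavesBelow_nil, value] using key [] F.root_mem

theorem value_mono (F : GameTree ι A L) (σ : F.Profile) {v w : List A → ℝ}
    (hvw : ∀ z ∈ F.leaves, v z ≤ w z) : F.value σ v ≤ F.value σ w :=
  Finset.sum_le_sum fun z hz => mul_le_mul_of_nonneg_left (hvw z hz)
    (F.reach_mem σ z (Finset.mem_filter.1 hz).1).1

theorem value_mul (F : GameTree ι A L) (σ : F.Profile) (c : ℝ) (v : List A → ℝ) :
    F.value σ (fun z => c * v z) = c * F.value σ v := by
  simp only [value, Finset.mul_sum]
  exact Finset.sum_congr rfl fun z _ => by ring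

theorem value_add (F : GameTree ι A L) (σ : F.Profile) (v w : List A → ℝ) :
    F.value σ (fun z => v z + w z) = F.value σ v + F.value σ w := by
  simp only [value, ← Finset.sum_add_distrib, mul_add]

theorem value_le_of_supermartingale (F : GameTree ι A L) (σ : F.Profile) (φ : List A → ℝ)
    (hφ : ∀ h ∈ F.internal, ∑ a ∈ F.actions h, F.stepProb σ h a * φ (a :: h) ≤ φ h) :
    F.value σ φ ≤ φ [] := by
  have := F.le_value_of_submartingale σ (fun h => -φ h) fun h hh => by
    simpa using hφ h hh
  simp only [value, mul_neg, Finset.sum_neg_distrib] at this ⊢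
  linarith

theorem stepProb_of_owner {F : GameTree ι A L} (σ : F.Profile) {h : List A} {i : ι}
    (ho : F.owner h = some i) (a : A) : F.stepProb σ h a = (σ i).prob (F.info h) a := by
  simp [stepProb, ho]

theorem value_update_le_bestResponseValue [DecidableEq ι] (F : GameTree ι A L) (σ : F.Profile)
    (i : ι) (v : List A → ℝ) (τ : F.Strategy i) :
    F.value (Function.update σ i τ) v ≤ F.bestResponseValue σ i v :=
  le_ciSup (F.bddAbove_value σ i v) τ

end GameTree

/-! ### The entropy inequality. -/

/-- Split `2r = (r/x)(2x)` and use `log t ≤ t - 1` for both factors. Summed over two outcomes, the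
terms `r - x` cancel and the terms `x(2x - 1)` give `1 - 4pq`. -/
theorem mul_log_two_mul_le {x r : ℝ} (hx : 0 ≤ x) (hr : 0 < r) :
    x * Real.log (2 * r) ≤ r - x + x * (2 * x - 1) := by
  rcases hx.eq_or_lt with rfl | hx
  · simpa using hr.le
  · have h1 : Real.log (2 * r) = Real.log (r / x) + Real.log (2 * x) := by
      rw [← Real.log_mul (by positivity) (by positivity)]
      congr 1
      field_simp
    have h2 := Real.log_le_sub_one_of_pos (div_pos hr hx)
    have h3 := Real.log_le_sub_one_of_pos (mul_pos two_pos hx)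
    calc x * Real.log (2 * r) ≤ x * ((r / x - 1) + (2 * x - 1)) := by
          rw [h1]; gcongr
      _ = _ := by field_simp

/-- A form of Gibbs' inequality for two outcomes, with a quadratic lower bound for the entropy. -/
theorem gibbs_two {p q a b : ℝ} (hp : 0 ≤ p) (hq : 0 ≤ q) (hpq : p + q = 1) (ha : 0 < a)
    (hb : 0 < b) :
    p * Real.log a + q * Real.log b + (Real.log 2 - 1 + 4 * (p * q)) ≤ Real.log (a + b) := by
  have hab : 0 < a + b := by positivity
  have key : ∀ {c : ℝ}, 0 < c →
      Real.log (2 * (c / (a + b))) = Real.log 2 + Real.log c - Real.log (a + b) := fun hc => by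
    rw [Real.log_mul two_ne_zero (by positivity), Real.log_div hc.ne' hab.ne']
    ring
  have h1 := mul_log_two_mul_le hp (div_pos ha hab)
  have h2 := mul_log_two_mul_le hq (div_pos hb hab)
  have h3 : a / (a + b) + b / (a + b) = 1 := by field_simp
  rw [key ha] at h1
  rw [key hb] at h2
  obtain rfl : q = 1 - p := by linarith
  linarith

/-! ### Structure and size of the game. -/

namespace MatchingPennies

theorem mem_nodes {T : ℕ} {h : List Bool} : h ∈ (game T).nodes ↔ h.length ≤ 2 * T := by
  simp [game]

theorem mem_actions {T : ℕ} {h : List Bool} {a : Bool} :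
    a ∈ (game T).actions h ↔ h.length + 1 ≤ 2 * T := by
  rw [GameTree.mem_actions, mem_nodes, List.length_cons]

theorem mem_internal {T : ℕ} {h : List Bool} : h ∈ (game T).internal ↔ h.length < 2 * T := by
  constructor
  · intro hh
    obtain ⟨a, ha⟩ := Finset.nonempty_iff_ne_empty.2 (Finset.mem_filter.1 hh).2
    have := mem_actions.1 ha
    omega
  · intro hh
    exact GameTree.mem_internal_of_cons (a := true)
      (mem_nodes.2 (by rw [List.length_cons]; omega))

theorem mem_leaves {T : ℕ} {h : List Bool} : h ∈ (game T).leaves ↔ h.length = 2 * T := by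
  constructor
  · intro hh
    have h1 := mem_nodes.1 (Finset.mem_filter.1 hh).1
    by_contra h2
    have h3 := mem_internal.2 (lt_of_le_of_ne h1 h2)
    exact (Finset.mem_filter.1 h3).2 (Finset.mem_filter.1 hh).2
  · intro hh
    rcases GameTree.mem_leaves_or_internal (mem_nodes.2 hh.le) with h1 | h1
    · exact h1
    · have := mem_internal.1 h1
      omega

theorem actions_of_mem_internal {T : ℕ} {h : List Bool} (hh : h ∈ (game T).internal) :
    (game T).actions h = Finset.univ := by
  ext a
  have := mem_internal.1 hh
  simpa [mem_actions] using this

theorem owner_eq (T : ℕ) (h : List Bool) :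
    (game T).owner h = some (if Even h.length then 0 else 1) := rfl

theorem numMatches_le : ∀ h : List Bool, numMatches h ≤ h.length / 2
  | [] => by simp [numMatches]
  | [_] => by simp [numMatches]
  | y :: x :: h => by
    have := numMatches_le h
    simp only [numMatches, List.length_cons]
    split_ifs <;> omega

/-- The information sets and moves of the first player, recovered from her moves alone. -/
def firstSequence : List Bool → List (List Bool × Bool)
  | [] => []
  | x :: l => (l, x) :: firstSequence l

theorem sequence_zero (T : ℕ) : ∀ h : List Bool, Even h.length →
    (game T).sequence 0 h = firstSequence (firstMoves h)
  | [], _ => rfl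
  | [_], hh => by simp at hh
  | y :: x :: h, hh => by
    have he : Even h.length := by simpa [Nat.even_add_one] using hh
    have ih := sequence_zero T h he
    simp only [GameTree.sequence, owner_eq, firstMoves, firstSequence, ← ih]
    simp [Nat.even_add_one, he, game, info]

/-- P1's sequence is a function of her own moves, which are her information. Two nodes in one
information set of P2 differ only in the last move, which is P1's. -/
theorem perfectRecall (T : ℕ) : (game T).PerfectRecall := by
  intro i h _ h' _ ho ho' hinfo
  have hpar : Even h.length ↔ Even h'.length := by
    rw [← ho', owner_eq, owner_eq] at ho
    by_cases h1 : Even h.length <;> by_cases h2 : Even h'.length <;>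
      simp only [h1, h2, if_true, if_false, Option.some.injEq] at ho ⊢ <;> simp at ho
  change info h = info h' at hinfo
  by_cases he : Even h.length
  · have he' := hpar.1 he
    obtain rfl : i = 0 := by simpa [owner_eq, he] using ho.symm
    rw [sequence_zero T h he, sequence_zero T h' he']
    simp only [info, he, he', if_true] at hinfo
    rw [hinfo]
  · have he' := fun h1 => he (hpar.2 h1)
    obtain rfl : i = 1 := by simpa [owner_eq, he] using ho.symm
    rw [info, info, if_neg he, if_neg he'] at hinfo
    match h, h' with
    | [], _ => simp at he
    | _, [] => simp at he'
    | x :: t, x' :: t' =>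
      obtain rfl : t = t' := hinfo
      have ht : Even t.length := by simpa [Nat.even_add_one] using he
      simp [GameTree.sequence, owner_eq, ht]

theorem card_leaves (T : ℕ) : (game T).leaves.card = 2 ^ (2 * T) := by
  have hcard : Fintype.card (List.Vector Bool (2 * T)) = 2 ^ (2 * T) := by
    rw [card_vector, Fintype.card_bool]
  rw [← hcard, ← Finset.card_univ]
  refine (Finset.card_bij (fun v _ => v.1) ?_ ?_ ?_).symm
  · exact fun v _ => mem_leaves.2 v.2
  · exact fun v _ w _ h => Subtype.ext h
  · exact fun z hz => ⟨⟨z, mem_leaves.1 hz⟩, Finset.mem_univ _, rfl⟩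

theorem card_nodes_le (T : ℕ) : (game T).nodes.card ≤ 2 * 2 ^ (2 * T) := by
  -- The `+ 1` makes the induction close: `m` nodes become at most `2m + 1`.
  have key : ∀ n : ℕ, (List.finite_length_le Bool n).toFinset.card + 1 ≤ 2 * 2 ^ n := by
    intro n
    induction n with
    | zero => simp
    | succ n ih =>
      have hsub : (List.finite_length_le Bool (n + 1)).toFinset ⊆
          insert [] ((Finset.univ ×ˢ (List.finite_length_le Bool n).toFinset).image
            fun p : Bool × List Bool => p.1 :: p.2) := by
        rintro (_ | ⟨a, l⟩) hl
        · simp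
        · refine Finset.mem_insert_of_mem (Finset.mem_image.2 ⟨(a, l), ?_, rfl⟩)
          simpa using hl
      have h1 := (Finset.card_le_card hsub).trans (Finset.card_insert_le _ _)
      have h2 := (Finset.card_image_le (s := Finset.univ ×ˢ (List.finite_length_le Bool n).toFinset)
        (f := fun p : Bool × List Bool => p.1 :: p.2))
      rw [Finset.card_product, Finset.card_univ, Fintype.card_bool] at h2
      rw [pow_succ]
      omega
  have := key (2 * T)
  change (List.finite_length_le Bool (2 * T)).toFinset.card ≤ _
  omega

theorem isUniformAlternating {T : ℕ} (hT : 1 ≤ T) :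
    (game T).IsUniformAlternating 2 (2 * T) where
  zero_sum z _ := by simp [game]
  bounded i z hz := by
    have hT' : (0 : ℝ) < T := by exact_mod_cast hT
    have h1 : |(numMatches z : ℝ) / T| ≤ 1 := by
      rw [abs_of_nonneg (by positivity), div_le_one hT']
      have h2 := numMatches_le z
      have h3 := mem_leaves.1 hz
      exact_mod_cast (by omega : numMatches z ≤ T)
    by_cases hi : i = 0 <;> simpa [game, hi] using h1
  perfect_recall := perfectRecall T
  no_nature h _ := by simp [owner_eq]
  alternating h _ a _ := by
    rw [owner_eq, owner_eq, List.length_cons]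
    by_cases he : Even h.length <;> simp [Nat.even_add_one, he]
  branching h hh := by simp [actions_of_mem_internal hh]
  depth z hz := mem_leaves.1 hz

end MatchingPennies

/-! ### Completed rounds and extreme continuations. -/

namespace MatchingPennies

/-- The number of completed rounds in which the two moves agree. -/
def completedMatches (h : List Bool) : ℕ :=
  if Even h.length then numMatches h else numMatches h.tail

/-- The number of completed rounds. -/
def completedRounds (h : List Bool) : ℕ := h.length / 2

theorem completedMatches_cons {t : List Bool} (ht : Even t.length) (x : Bool) :
    completedMatches (x :: t) = completedMatches t := by
  simp [completedMatches, Nat.even_add_one, ht]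

theorem completedMatches_cons_cons {t : List Bool} (ht : Even t.length) (x y : Bool) :
    completedMatches (y :: x :: t) = (if x = y then 1 else 0) + completedMatches t := by
  simp [completedMatches, ht, numMatches]

theorem completedRounds_cons {t : List Bool} (ht : Even t.length) (x : Bool) :
    completedRounds (x :: t) = completedRounds t := by
  have := Nat.even_iff.1 ht
  simp only [completedRounds, List.length_cons]
  omega

theorem completedRounds_cons_cons (t : List Bool) (x y : Bool) :
    completedRounds (y :: x :: t) = completedRounds t + 1 := by
  simp only [completedRounds, List.length_cons]
  omega

theorem exists_extension_agreeing (n : ℕ) (h : List Bool) :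
    ∃ z, h <:+ z ∧ z.length = h.length + 2 * n ∧ numMatches z = numMatches h + n := by
  induction n with
  | zero => exact ⟨h, List.suffix_rfl, rfl, rfl⟩
  | succ n ih =>
    obtain ⟨z, hs, hl, hm⟩ := ih
    refine ⟨true :: true :: z,
      hs.trans ((List.suffix_cons _ z).trans (List.suffix_cons _ _)), ?_, ?_⟩
    · simp only [List.length_cons]
      omega
    · simp only [numMatches, if_true]
      omega

theorem exists_extension_differing (n : ℕ) (h : List Bool) :
    ∃ z, h <:+ z ∧ z.length = h.length + 2 * n ∧ numMatches z = numMatches h := by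
  induction n with
  | zero => exact ⟨h, List.suffix_rfl, rfl, rfl⟩
  | succ n ih =>
    obtain ⟨z, hs, hl, hm⟩ := ih
    refine ⟨true :: false :: z,
      hs.trans ((List.suffix_cons _ z).trans (List.suffix_cons _ _)), ?_, ?_⟩
    · simp only [List.length_cons]
      omega
    · simp [numMatches, hm]

theorem exists_leaf_agreeing {T : ℕ} {h : List Bool} (hh : h.length ≤ 2 * T) :
    ∃ z ∈ (game T).leaves, h <:+ z ∧
      numMatches z + completedRounds h = completedMatches h + T := by
  rcases Nat.even_or_odd h.length with he | ho
  · obtain ⟨z, hs, hl, hm⟩ := exists_extension_agreeing (T - h.length / 2) h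
    have h2 := Nat.even_iff.1 he
    refine ⟨z, mem_leaves.2 (by omega), hs, ?_⟩
    rw [completedRounds, completedMatches, if_pos he]
    omega
  · match h with
    | [] => simp at ho
    | x :: t =>
      have ht : Even t.length := by simpa [Nat.odd_add_one] using ho
      have h2 := Nat.even_iff.1 ht
      rw [List.length_cons] at hh
      -- In the middle of a round, P2 first answers the pending move `x` with a match.
      obtain ⟨z, hs, hl, hm⟩ := exists_extension_agreeing (T - (t.length / 2 + 1)) (x :: x :: t)
      simp only [List.length_cons, numMatches, if_true] at hl hm
      refine ⟨z, mem_leaves.2 (by omega), (List.suffix_cons _ _).trans hs, ?_⟩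
      rw [completedRounds, completedMatches, if_neg (Nat.not_even_iff_odd.2 ho), List.tail_cons,
        List.length_cons]
      omega

theorem exists_leaf_differing {T : ℕ} {h : List Bool} (hh : h.length ≤ 2 * T) :
    ∃ z ∈ (game T).leaves, h <:+ z ∧ numMatches z = completedMatches h := by
  rcases Nat.even_or_odd h.length with he | ho
  · obtain ⟨z, hs, hl, hm⟩ := exists_extension_differing (T - h.length / 2) h
    have h2 := Nat.even_iff.1 he
    refine ⟨z, mem_leaves.2 (by omega), hs, ?_⟩
    rw [completedMatches, if_pos he, hm]
  · match h with
    | [] => simp at ho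
    | x :: t =>
      have ht : Even t.length := by simpa [Nat.odd_add_one] using ho
      have h2 := Nat.even_iff.1 ht
      rw [List.length_cons] at hh
      obtain ⟨z, hs, hl, hm⟩ := exists_extension_differing (T - (t.length / 2 + 1)) ((!x) :: x :: t)
      simp only [List.length_cons] at hl
      refine ⟨z, mem_leaves.2 (by omega), (List.suffix_cons _ _).trans hs, ?_⟩
      rw [completedMatches, if_neg (Nat.not_even_iff_odd.2 ho), List.tail_cons, hm]
      simp [numMatches]

/-! ### Trunks of the game, the two deviations and the bounds at leaves. -/

section Trunk

variable {T : ℕ} {P : Pseudogame (Fin 2) Bool (List Bool)}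

theorem trunk_actions (hP : P.IsTrunk (game T)) {h : List Bool} (hh : h ∈ P.internal) :
    P.actions h = Finset.univ ∧ h.length < 2 * T := by
  obtain ⟨a, ha⟩ := Finset.nonempty_iff_ne_empty.2 (Finset.mem_filter.1 hh).2
  rw [hP.actions_eq h hh] at ha ⊢
  have h1 := GameTree.mem_internal_of_cons (GameTree.mem_actions.1 ha)
  exact ⟨actions_of_mem_internal h1, mem_internal.1 h1⟩

theorem trunk_cons_mem (hP : P.IsTrunk (game T)) {h : List Bool} (hh : h ∈ P.internal)
    (a : Bool) : a :: h ∈ P.nodes :=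
  GameTree.mem_actions.1 ((trunk_actions hP hh).1 ▸ Finset.mem_univ a)

theorem trunk_length_le (hP : P.IsTrunk (game T)) {h : List Bool} (hh : h ∈ P.nodes) :
    h.length ≤ 2 * T :=
  mem_nodes.1 (hP.nodes_subset hh)

theorem trunk_first (hP : P.IsTrunk (game T)) {h : List Bool} (hh : h ∈ P.internal)
    (he : Even h.length) : P.owner h = some 0 ∧ P.info h = firstMoves h := by
  rw [hP.owner_eq h hh, hP.info_eq h hh, owner_eq, if_pos he]
  exact ⟨rfl, if_pos he⟩

theorem trunk_second (hP : P.IsTrunk (game T)) {x : Bool} {h : List Bool}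
    (hh : x :: h ∈ P.internal) (he : Even h.length) :
    P.owner (x :: h) = some 1 ∧ P.info (x :: h) = h := by
  have ho : ¬Even (x :: h).length := by simpa [Nat.even_add_one] using he
  rw [hP.owner_eq _ hh, hP.info_eq _ hh, owner_eq, if_neg ho]
  exact ⟨rfl, if_neg ho⟩

theorem exists_cons_of_owner_one (hP : P.IsTrunk (game T)) {h : List Bool} (hh : h ∈ P.internal)
    (ho : P.owner h = some 1) : ∃ x t, h = x :: t ∧ Even t.length ∧ t ∈ P.internal := by
  have he : ¬Even h.length := by
    intro he
    rw [hP.owner_eq h hh, owner_eq, if_pos he] at ho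
    simp at ho
  match h with
  | [] => simp at he
  | x :: t =>
    exact ⟨x, t, rfl, by simpa [Nat.even_add_one] using he,
      GameTree.mem_internal_of_cons (Finset.mem_filter.1 hh).1⟩

theorem first_prob (hP : P.IsTrunk (game T)) (τ : P.toGameTree.Strategy 0) {h : List Bool}
    (hh : h ∈ P.internal) (he : Even h.length) :
    (∀ a, 0 ≤ τ.prob (firstMoves h) a) ∧
      τ.prob (firstMoves h) true + τ.prob (firstMoves h) false = 1 := by
  obtain ⟨ho, hi⟩ := trunk_first hP hh he
  have h1 := τ.nonneg h hh ho
  have h2 := τ.sum_eq_one h hh ho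
  simp only [(trunk_actions hP hh).1, hi, Fintype.sum_bool] at h1 h2
  exact ⟨fun a => h1 a (Finset.mem_univ a), h2⟩

theorem second_prob (hP : P.IsTrunk (game T)) (τ : P.toGameTree.Strategy 1) {x : Bool}
    {h : List Bool} (hh : x :: h ∈ P.internal) (he : Even h.length) :
    (∀ a, 0 ≤ τ.prob h a) ∧ τ.prob h true + τ.prob h false = 1 := by
  obtain ⟨ho, hi⟩ := trunk_second hP hh he
  have h1 := τ.nonneg _ hh ho
  have h2 := τ.sum_eq_one _ hh ho
  simp only [(trunk_actions hP hh).1, hi, Fintype.sum_bool] at h1 h2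
  exact ⟨fun a => h1 a (Finset.mem_univ a), h2⟩

/-- The first player tosses a fair coin in every round. -/
noncomputable def fairStrategy (hP : P.IsTrunk (game T)) : P.toGameTree.Strategy 0 where
  prob _ _ := 1 / 2
  nonneg _ _ _ _ _ := by norm_num
  sum_eq_one h hh _ := by
    rw [(trunk_actions hP hh).1]
    norm_num

/-- The second player exchanges the two probabilities of the first player in every round. -/
noncomputable def mirrorStrategy (hP : P.IsTrunk (game T)) (τ : P.toGameTree.Strategy 0) :
    P.toGameTree.Strategy 1 where
  prob h a := τ.prob (firstMoves h) (!a)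
  nonneg h hh ho a _ := by
    obtain ⟨x, t, rfl, he, ht⟩ := exists_cons_of_owner_one hP hh ho
    rw [(trunk_second hP hh he).2]
    exact (first_prob hP τ ht he).1 _
  sum_eq_one h hh ho := by
    obtain ⟨x, t, rfl, he, ht⟩ := exists_cons_of_owner_one hP hh ho
    rw [(trunk_second hP hh he).2, (trunk_actions hP hh).1, Fintype.sum_bool]
    exact (add_comm _ _).trans (first_prob hP τ ht he).2

/-- P1's upper bound must allow for a continuation in which every unfinished round is a match. -/
theorem agreeing_bounds (hT : 1 ≤ T) (hP : P.IsTrunk (game T)) {z : List Bool}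
    (hz : z ∈ P.leaves) :
    (completedMatches z + (T - completedRounds z) : ℝ) ≤ T * P.upper 0 z := by
  obtain ⟨w, hw, hs, hm⟩ := exists_leaf_agreeing (trunk_length_le hP (Finset.mem_filter.1 hz).1)
  have h1 := (hP.bounds 0 z hz w hw hs).2
  have hT' : (0 : ℝ) < T := by exact_mod_cast hT
  simp only [game, if_true] at h1
  rw [div_le_iff₀ hT'] at h1
  have h2 : (numMatches w + completedRounds z : ℝ) = completedMatches z + T := by
    exact_mod_cast hm
  linarith

/-- P2's upper bound must allow for a continuation without further matches. The same leaf, where the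
utilities sum to 0, bounds the sum of the lower bounds. -/
theorem differing_bounds (hT : 1 ≤ T) (hP : P.IsTrunk (game T)) {z : List Bool}
    (hz : z ∈ P.leaves) :
    -(completedMatches z : ℝ) ≤ T * P.upper 1 z ∧ P.lower 0 z + P.lower 1 z ≤ 0 := by
  obtain ⟨w, hw, hs, hm⟩ := exists_leaf_differing (trunk_length_le hP (Finset.mem_filter.1 hz).1)
  have h0 := hP.bounds 0 z hz w hw hs
  have h1 := hP.bounds 1 z hz w hw hs
  have hT' : (0 : ℝ) < T := by exact_mod_cast hT
  simp only [game, if_true, one_ne_zero, if_false, hm] at h0 h1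
  refine ⟨?_, by linarith⟩
  have h2 := h1.2
  rw [← neg_div, div_le_iff₀ hT'] at h2
  linarith

end Trunk

end MatchingPennies

/-! ### The values of the two deviations. -/

namespace MatchingPennies

variable {T : ℕ} {P : Pseudogame (Fin 2) Bool (List Bool)}

theorem completedRounds_le (hP : P.IsTrunk (game T)) {h : List Bool} (hh : h ∈ P.nodes) :
    completedRounds h ≤ T := by
  have := trunk_length_le hP hh
  simp only [completedRounds]
  omega

theorem completedRounds_lt (hP : P.IsTrunk (game T)) {h : List Bool} (hh : h ∈ P.internal) :
    completedRounds h < T := by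
  have := (trunk_actions hP hh).2
  simp only [completedRounds]
  omega

/-- A property of the children of all internal nodes follows from the cases of the two players. -/
theorem forall_internal {p : List Bool → Prop}
    (hfirst : ∀ h ∈ P.internal, Even h.length → p h)
    (hsecond : ∀ x h, x :: h ∈ P.internal → h ∈ P.internal → Even h.length → p (x :: h)) :
    ∀ h ∈ P.internal, p h := by
  intro h hh
  by_cases he : Even h.length
  · exact hfirst h hh he
  · match h with
    | [] => simp at he
    | x :: t =>
      exact hsecond x t hh (GameTree.mem_internal_of_cons (Finset.mem_filter.1 hh).1)
        (by simpa [Nat.even_add_one] using he)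

/-- Against a fair coin every round is matched with probability 1/2; cutting the tree off only
helps, since optimistic bounds count unfinished rounds as matches. -/
theorem half_le_value_fair (hT : 1 ≤ T) (hP : P.IsTrunk (game T)) (σ : P.toGameTree.Profile) :
    (T : ℝ) / 2 ≤ T * P.value (Function.update σ 0 (fairStrategy hP)) (P.upper 0) := by
  classical
  set σ' := Function.update σ 0 (fairStrategy hP) with hσ'
  -- The chance that P2 matches the pending move, or 1 if the trunk stops there. Used only at odd
  -- length, so the default of `headD` never matters.
  set c : List Bool → ℝ := fun h =>
    if h ∈ P.internal then (σ 1).prob h.tail (h.headD true) else 1 with hc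
  set φ : List Bool → ℝ := fun h =>
    if Even h.length then completedMatches h + (T - completedRounds h) / 2
    else completedMatches h + (T - completedRounds h - 1) / 2 + c h with hφ
  have hφ0 : ∀ h : List Bool, Even h.length →
      φ h = completedMatches h + (T - completedRounds h) / 2 := fun h he => if_pos he
  have hφ1 : ∀ (x : Bool) (h : List Bool), Even h.length →
      φ (x :: h) = completedMatches h + (T - completedRounds h - 1) / 2 + c (x :: h) := by
    intro x h he
    have ho : ¬Even (x :: h).length := by simpa [Nat.even_add_one] using he
    rw [hφ]
    simp only [if_neg ho, completedMatches_cons he, completedRounds_cons he]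
  have hsub := P.le_value_of_submartingale σ' φ (forall_internal ?_ ?_)
  · have hroot : φ [] = T / 2 := by simp [hφ, completedMatches, completedRounds, numMatches]
    rw [← hroot]
    refine hsub.trans (le_trans (P.value_mono σ' fun z hz => ?_)
      (P.value_mul σ' T (P.upper 0)).le)
    refine le_trans ?_ (agreeing_bounds hT hP hz)
    have hz1 := (Finset.mem_filter.1 hz).1
    by_cases he : Even z.length
    · rw [hφ0 z he]
      have : (completedRounds z : ℝ) ≤ T := by exact_mod_cast completedRounds_le hP hz1
      linarith
    · match z with
      | [] => simp at he
      | x :: t =>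
        have ht : Even t.length := by simpa [Nat.even_add_one] using he
        have h1 : (completedRounds t + 1 : ℝ) ≤ T := by
          exact_mod_cast completedRounds_lt hP (GameTree.mem_internal_of_cons hz1)
        have h2 : x :: t ∉ P.internal := fun h3 =>
          (Finset.mem_filter.1 h3).2 (Finset.mem_filter.1 hz).2
        rw [hφ1 x t ht, completedMatches_cons ht, completedRounds_cons ht, hc]
        simp only [if_neg h2]
        linarith
  · intro h hh he
    have hstep : ∀ a, P.stepProb σ' h a = 1 / 2 := fun a => by
      rw [GameTree.stepProb_of_owner σ' (trunk_first hP hh he).1]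
      simp [hσ', fairStrategy]
    -- If both children are internal they share an information set of P2, and equality holds; a
    -- collapsed child alone already contributes 1.
    have hsum : 1 ≤ c (true :: h) + c (false :: h) := by
      have hprob : ∀ x, x :: h ∈ P.internal → (∀ a, 0 ≤ (σ 1).prob h a) ∧
          (σ 1).prob h true + (σ 1).prob h false = 1 := fun x hx => second_prob hP (σ 1) hx he
      simp only [hc, List.tail_cons, List.headD_cons]
      split_ifs with h1 h2 h2
      · exact (hprob _ h1).2.ge
      · linarith [(hprob _ h1).1 true]
      · linarith [(hprob _ h2).1 false]
      · norm_num
    rw [(trunk_actions hP hh).1, Fintype.sum_bool, hstep, hstep, hφ0 h he, hφ1 _ h he,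
      hφ1 _ h he]
    linarith
  · intro x h hh _ he
    have hstep : ∀ a, P.stepProb σ' (x :: h) a = (σ 1).prob h a := fun a => by
      rw [GameTree.stepProb_of_owner σ' (trunk_second hP hh he).1, (trunk_second hP hh he).2]
      simp [hσ']
    have he2 : ∀ y, Even (y :: x :: h).length := fun y => by
      simpa [Nat.even_add_one] using he
    have hsum := (second_prob hP (σ 1) hh he).2
    have hcx : c (x :: h) = (σ 1).prob h x := by simp [hc, hh]
    rw [(trunk_actions hP hh).1, Fintype.sum_bool, hstep, hstep, hφ0 _ (he2 _), hφ0 _ (he2 _),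
      hφ1 x h he, completedMatches_cons_cons he, completedMatches_cons_cons he,
      completedRounds_cons_cons, completedRounds_cons_cons, hcx]
    obtain hf : (σ 1).prob h false = 1 - (σ 1).prob h true := by linarith
    cases x <;> push_cast <;> simp [hf] <;> linarith

/-- The tree is large if the first player is often matched by the mirror strategy. -/
theorem value_mirror_le_log (hP : P.IsTrunk (game T)) (σ : P.toGameTree.Profile) :
    4 * P.value (Function.update σ 1 (mirrorStrategy hP (σ 0))) (fun z => completedMatches z) ≤
      Real.log P.leaves.card + 2 * T * (1 - Real.log 2) := by
  set σ' := Function.update σ 1 (mirrorStrategy hP (σ 0)) with hσ'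
  have hlog : Real.log 2 ≤ 1 := by linarith [Real.log_le_sub_one_of_pos two_pos]
  set n : List Bool → ℝ := fun h => (P.leavesBelow h).card with hn
  have hnpos : ∀ h ∈ P.nodes, 1 ≤ n h := fun h hh => by
    exact Nat.one_le_cast.2 (Finset.card_pos.2 (GameTree.leavesBelow_nonempty h hh))
  have hnadd : ∀ h ∈ P.internal, n h = n (true :: h) + n (false :: h) := fun h hh => by
    have h1 := GameTree.sum_leavesBelow_of_mem_internal hh fun _ => (1 : ℝ)
    rw [(trunk_actions hP hh).1, Fintype.sum_bool] at h1
    simpa [hn] using h1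
  set p : List Bool → Bool → ℝ := fun h => (σ 0).prob (firstMoves h) with hp
  -- Each remaining round has an allowance `2(1 - log 2)`, one half per move. After P1's move `x`,
  -- half is spent; the expected match term `4p(!x)` less P2's entropy term `4p(!x)(1 - p(!x))`
  -- leaves `4p(!x)²`.
  set φ : List Bool → ℝ := fun h =>
    2 * (T - completedRounds h) * (1 - Real.log 2) + 4 * completedMatches h + Real.log (n h) +
      if Even h.length then 0 else 4 * p h.tail (!(h.headD true)) ^ 2 - (1 - Real.log 2) with hφ
  have hφ0 : ∀ h : List Bool, Even h.length → φ h =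
      2 * (T - completedRounds h) * (1 - Real.log 2) + 4 * completedMatches h +
        Real.log (n h) := fun h he => by
    simp only [hφ, if_pos he, add_zero]
  have hφ1 : ∀ (x : Bool) (h : List Bool), Even h.length → φ (x :: h) =
      2 * (T - completedRounds h) * (1 - Real.log 2) + 4 * completedMatches h +
        Real.log (n (x :: h)) + (4 * p h (!x) ^ 2 - (1 - Real.log 2)) := by
    intro x h he
    have ho : ¬Even (x :: h).length := by simpa [Nat.even_add_one] using he
    simp only [hφ, if_neg ho, completedMatches_cons he, completedRounds_cons he, List.tail_cons,
      List.headD_cons]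
  have hsuper := P.value_le_of_supermartingale σ' φ (forall_internal ?_ ?_)
  · have hroot : φ [] = Real.log P.leaves.card + 2 * T * (1 - Real.log 2) := by
      simp [hφ, completedMatches, completedRounds, numMatches, hn, GameTree.leavesBelow_nil]
      ring
    rw [← hroot]
    refine le_trans ?_ hsuper
    rw [← P.value_mul]
    refine P.value_mono σ' fun z hz => ?_
    have hz1 := (Finset.mem_filter.1 hz).1
    have hlogn := Real.log_nonneg (hnpos z hz1)
    by_cases he : Even z.length
    · rw [hφ0 z he]
      have h1 : (completedRounds z : ℝ) ≤ T := by exact_mod_cast completedRounds_le hP hz1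
      have h2 := mul_nonneg (sub_nonneg.2 h1) (sub_nonneg.2 hlog)
      linarith
    · match z with
      | [] => simp at he
      | x :: t =>
        have ht : Even t.length := by simpa [Nat.even_add_one] using he
        have h1 : (completedRounds t + 1 : ℝ) ≤ T := by
          exact_mod_cast completedRounds_lt hP (GameTree.mem_internal_of_cons hz1)
        -- A leaf inside a round has spent only one of that round's two allowances.
        have h2 := mul_nonneg (by linarith : (0 : ℝ) ≤ 2 * (T - completedRounds t) - 1)
          (sub_nonneg.2 hlog)
        rw [hφ1 x t ht, completedMatches_cons ht]
        linarith [sq_nonneg (p t (!x))]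
  · intro h hh he
    have hstep : ∀ a, P.stepProb σ' h a = p h a := fun a => by
      rw [GameTree.stepProb_of_owner σ' (trunk_first hP hh he).1, (trunk_first hP hh he).2]
      simp [hσ', hp]
    obtain ⟨hnn, hsum⟩ : (∀ a, 0 ≤ p h a) ∧ p h true + p h false = 1 := first_prob hP (σ 0) hh he
    have hpos : ∀ a, 0 < n (a :: h) := fun a => by
      linarith [hnpos _ (trunk_cons_mem hP hh a)]
    -- The squares average to `4(pq² + qp²) = 4pq`, exactly the gain in Gibbs' inequality.
    have hgibbs := gibbs_two (hnn true) (hnn false) hsum (hpos true) (hpos false)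
    rw [(trunk_actions hP hh).1, Fintype.sum_bool, hstep, hstep, hφ0 h he, hφ1 _ h he,
      hφ1 _ h he, hnadd h hh]
    obtain hf : p h false = 1 - p h true := by linarith
    simp only [Bool.not_true, Bool.not_false, hf] at hgibbs ⊢
    linear_combination hgibbs
  · intro x h hh hh' he
    have hstep : ∀ a, P.stepProb σ' (x :: h) a = p h (!a) := fun a => by
      rw [GameTree.stepProb_of_owner σ' (trunk_second hP hh he).1, (trunk_second hP hh he).2]
      simp [hσ', hp, mirrorStrategy]
    have he2 : ∀ y, Even (y :: x :: h).length := fun y => by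
      simpa [Nat.even_add_one] using he
    obtain ⟨hnn, hsum⟩ : (∀ a, 0 ≤ p h a) ∧ p h true + p h false = 1 := first_prob hP (σ 0) hh' he
    have hpos : ∀ a, 0 < n (a :: x :: h) := fun a => by
      linarith [hnpos _ (trunk_cons_mem hP hh a)]
    -- The mirror strategy plays `true` with P1's probability of `false`.
    have hgibbs := gibbs_two (hnn false) (hnn true) (by linarith) (hpos true) (hpos false)
    rw [(trunk_actions hP hh).1, Fintype.sum_bool, hstep, hstep, hφ0 _ (he2 _), hφ0 _ (he2 _),
      hφ1 x h he, completedMatches_cons_cons he, completedMatches_cons_cons he,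
      completedRounds_cons_cons, completedRounds_cons_cons, hnadd _ hh]
    obtain hf : p h false = 1 - p h true := by linarith
    simp only [Bool.not_true, Bool.not_false, hf] at hgibbs ⊢
    cases x <;> simp [hf] <;> linear_combination hgibbs

/-! ### From the equilibrium condition to the size bound. -/

/-- The two equilibrium conditions add up to `T/2 - E ≤ 2εT`, with `E` the expected number of
completed matches under the mirror strategy; then `4E` is bounded by entropy. -/
theorem log_card_leaves_ge (hT : 1 ≤ T) {ε : ℝ} {σ : P.toGameTree.Profile}
    (hc : (game T).IsCertificate ε P σ) :
    2 * T * Real.log 2 - 8 * ε * T ≤ Real.log P.leaves.card := by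
  obtain ⟨hP, hN⟩ := hc
  have hT' : (0 : ℝ) < T := by exact_mod_cast hT
  have h1 := half_le_value_fair hT hP σ
  have h2 := value_mirror_le_log hP σ
  set τ := mirrorStrategy hP (σ 0)
  have h3 := P.value_update_le_bestResponseValue σ 0 (P.upper 0) (fairStrategy hP)
  have h4 := P.value_update_le_bestResponseValue σ 1 (P.upper 1) τ
  have h5 : -P.value (Function.update σ 1 τ) (fun z => completedMatches z) ≤
      T * P.value (Function.update σ 1 τ) (P.upper 1) := by
    rw [← neg_one_mul, ← P.value_mul, ← P.value_mul]
    refine P.value_mono _ fun z hz => ?_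
    rw [neg_one_mul]
    exact (differing_bounds hT hP hz).1
  have h6 : P.value σ (P.lower 0) + P.value σ (P.lower 1) ≤ 0 := by
    rw [← P.value_add]
    -- The zero payoff, written as a multiple so that `value_mul` evaluates it.
    refine (P.value_mono σ (w := fun z => 0 * P.lower 0 z) fun z hz => ?_).trans ?_
    · simpa using (differing_bounds hT hP hz).2
    · rw [P.value_mul, zero_mul]
  have h7 := mul_le_mul_of_nonneg_left
    (by linarith [hN 0, hN 1] : P.value (Function.update σ 0 (fairStrategy hP)) (P.upper 0) +
      P.value (Function.update σ 1 τ) (P.upper 1) ≤ 2 * ε) hT'.le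
  rw [mul_add] at h7
  linarith

theorem rpow_le_card_nodes (hT : 1 ≤ T) {ε : ℝ} {σ : P.toGameTree.Profile}
    (hc : (game T).IsCertificate ε P σ) :
    ((2 : ℝ) ^ (2 * T)) ^ (1 - 4 / Real.log 2 * ε) ≤ (P.nodes.card : ℝ) := by
  have hlog : 0 < Real.log 2 := Real.log_pos one_lt_two
  have h1 : 1 ≤ P.leaves.card := by
    rw [← GameTree.leavesBelow_nil]
    exact Finset.card_pos.2 (GameTree.leavesBelow_nonempty [] P.root_mem)
  have h2 : P.leaves.card ≤ P.nodes.card := Finset.card_le_card (Finset.filter_subset _ _)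
  have h3 := log_card_leaves_ge hT hc
  calc ((2 : ℝ) ^ (2 * T)) ^ (1 - 4 / Real.log 2 * ε)
      = Real.exp (2 * T * Real.log 2 - 8 * ε * T) := by
        rw [Real.rpow_def_of_pos (by positivity), Real.log_pow]
        congr 1
        push_cast
        field_simp
        ring
    _ ≤ Real.exp (Real.log P.leaves.card) := Real.exp_le_exp.2 h3
    _ = P.leaves.card := Real.exp_log (by exact_mod_cast h1)
    _ ≤ P.nodes.card := by exact_mod_cast h2

/-- The game has at most `2N` nodes, so it suffices that `N^(t - r) > |K| 2^r`. Passing to `r = max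
s 0` makes the power monotone even for negative `s`. -/
theorem exists_rpow_lt (K : ℝ) {s t : ℝ} (hst : s < t) (ht : 0 < t) :
    ∃ T : ℕ, 1 ≤ T ∧ K * ((game T).nodes.card : ℝ) ^ s < ((2 : ℝ) ^ (2 * T)) ^ t := by
  set r := max s 0
  have hr : r < t := max_lt hst ht
  have hlim : Filter.Tendsto (fun T : ℕ => ((2 : ℝ) ^ (2 * T)) ^ (t - r)) Filter.atTop
      Filter.atTop := by
    refine (tendsto_rpow_atTop (sub_pos.2 hr)).comp ?_
    exact (tendsto_pow_atTop_atTop_of_one_lt one_lt_two).comp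
      (Filter.tendsto_id.const_mul_atTop' two_pos)
  obtain ⟨T, hT, hT1⟩ :=
    ((hlim.eventually_gt_atTop (|K| * 2 ^ r)).and (Filter.eventually_ge_atTop 1)).exists
  refine ⟨T, hT1, ?_⟩
  have hN : (0 : ℝ) < 2 ^ (2 * T) := by positivity
  have hM : (1 : ℝ) ≤ (game T).nodes.card := by
    exact_mod_cast Finset.card_pos.2 ⟨_, (game T).root_mem⟩
  have hM2 : ((game T).nodes.card : ℝ) ≤ 2 * 2 ^ (2 * T) := by exact_mod_cast card_nodes_le T
  calc K * ((game T).nodes.card : ℝ) ^ s ≤ |K| * ((game T).nodes.card : ℝ) ^ r := by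
        gcongr
        · exact le_abs_self K
        · exact le_max_left s 0
    _ ≤ |K| * (2 * 2 ^ (2 * T)) ^ r := by
        gcongr
    _ = |K| * 2 ^ r * (2 ^ (2 * T)) ^ r := by
        rw [Real.mul_rpow two_pos.le hN.le, mul_assoc]
    _ < (2 ^ (2 * T)) ^ (t - r) * (2 ^ (2 * T)) ^ r := by gcongr
    _ = (2 ^ (2 * T)) ^ t := by rw [← Real.rpow_add hN, sub_add_cancel]

end MatchingPennies

theorem mainTheorem1 :
    -- the game is a uniform alternating binary zero-sum game with `2 ^ (2 * T)` leaves
    (∀ T : ℕ, 1 ≤ T →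
      (MatchingPennies.game T).IsUniformAlternating 2 (2 * T) ∧
      (MatchingPennies.game T).leaves.card = 2 ^ (2 * T)) ∧
    -- every certificate of it has `Ω(N ^ (1 - O(ε)))` nodes
    (∃ c : ℝ, 0 < c ∧ ∃ C : ℝ, 0 < C ∧ ∀ T : ℕ, 1 ≤ T → ∀ ε : ℝ, 0 ≤ ε →
      ∀ (P : Pseudogame (Fin 2) Bool (List Bool)) (σ : P.toGameTree.Profile),
        (MatchingPennies.game T).IsCertificate ε P σ →
        c * ((2 : ℝ) ^ (2 * T)) ^ (1 - C * ε) ≤ (P.nodes.card : ℝ)) ∧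
    -- hence small approximate certificates need not exist
    (∀ s : ℝ, s < 1 → ∃ ε : ℝ, 0 < ε ∧ ∀ K : ℝ,
      ∃ (L : Type) (d : ℕ) (G : Game (Fin 2) Bool L), G.IsUniformAlternating 2 d ∧
        ∀ (P : Pseudogame (Fin 2) Bool L) (σ : P.toGameTree.Profile),
          G.IsCertificate ε P σ → K * (G.nodes.card : ℝ) ^ s < (P.nodes.card : ℝ)) := by
  have hlog : 0 < Real.log 2 := Real.log_pos one_lt_two
  refine ⟨fun T hT => ⟨MatchingPennies.isUniformAlternating hT, MatchingPennies.card_leaves T⟩,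
    ⟨1, one_pos, 4 / Real.log 2, by positivity, fun T hT ε _ P σ hc => ?_⟩, fun s hs => ?_⟩
  · rw [one_mul]
    exact MatchingPennies.rpow_le_card_nodes hT hc
  · set r := max s 0
    have hr : r < 1 := max_lt hs one_pos
    have hr0 : 0 ≤ r := le_max_right s 0
    -- Chosen so that the exponent `1 - Cε` is `(1 + r) / 2`, halfway between `r` and 1.
    refine ⟨Real.log 2 / 4 * ((1 - r) / 2), mul_pos (by positivity) (by linarith), fun K => ?_⟩
    obtain ⟨T, hT, hlt⟩ := MatchingPennies.exists_rpow_lt K (s := s) (t := (1 + r) / 2)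
      (by linarith [le_max_left s 0]) (by linarith)
    refine ⟨List Bool, 2 * T, MatchingPennies.game T, MatchingPennies.isUniformAlternating hT,
      fun P σ hc => hlt.trans_le ?_⟩
    have hexp : 1 - 4 / Real.log 2 * (Real.log 2 / 4 * ((1 - r) / 2)) = (1 + r) / 2 := by
      field_simp
      ring
    simpa only [hexp] using MatchingPennies.rpow_le_card_nodes hT hc
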